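/- \textbf{Proposition.} Let $X$ be an (abstract) tropical $n$-cycle, let $\mathcal E$ and $\mathcal F$ be tropical vector bundles over $X$ of ranks $e$ and $f$, and let $\varphi\colon\mathcal E\to\mathcal F$ be a morphism of tropical vector bundles. Thus $X$ is covered by finitely many open sets $U$ that carry local trivializations of both bundles, in which $\varphi$ is given by $(x,a)\mapsto(x,f_{A_U(x)}(a))$. Here $A_U(x)$ is an $f\times e$ matrix over $\mathbb T=(\mathbb R\cup\{-\infty\},\max,+)$ with at most one finite entry in each row; each entry of $A_U$ is a regular invertible function on $U$ or constantly $-\infty$; and $f_A\colon\mathbb R^e\to\mathbb R^f$ is the map $a\mapsto A\odot a$ in which entries $-\infty$ of $A\odot a$ are replaced by $0$. For $p\in U$ let $\varphi_p\colon\mathbb T^e\to\mathbb T^f$ be the stalk map with matrix $A_U(p)$, and let $\operatorname{troprank}(\varphi_p)$ be the largest $j$ such that $A_U(p)$ has a $j\times j$ minor (tropical determinant of a submatrix) different from $-\infty$. For an integer $k\ge 0$ put $$D_k(\varphi)=\{p\in|X| \;:\; \operatorname{troprank}(\varphi_p)\le k\}.$$ Then $\operatorname{troprank}(\varphi_p)$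 does not depend on the local trivializations, $D_k(\varphi)$ is a union of connected components of $|X|$, and $D_k(\varphi)$ is a tropical subcycle of $X$. More precisely, there is a (possibly empty) tropical $n$-cycle $D$ that is a subcycle of $X$, has support $|D|=D_k(\varphi)$, and inherits its tropical structure and its weights from $X$. -/

import Mathlib

open Set Topology

/-! ## Tropical linear algebra -/

/-- The tropical numbers `ℝ ∪ {-∞}`, with `⊕ = ⊔` and `⊙ = +`. -/
abbrev TropNum : Type := WithBot ℝ

/-- Tropical matrices. -/
abbrev TropMatrix (r s : ℕ) : Type := Matrix (Fin r) (Fin s) TropNum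

namespace TropMatrix

/-- `G(r × s)`: at most one finite entry in each row. -/
def IsRowSparse {r s : ℕ} (A : TropMatrix r s) : Prop :=
  ∀ i j j', A i j ≠ ⊥ → A i j' ≠ ⊥ → j = j'

/-- `G(r)`: exactly one finite entry in each row and in each column. -/
def IsInvertible {r : ℕ} (A : TropMatrix r r) : Prop :=
  (∀ i, ∃! j, A i j ≠ ⊥) ∧ ∀ j, ∃! i, A i j ≠ ⊥

/-- The map `f_A : ℝ^s → ℝ^r`, `x ↦ A ⊙ x`, where entries `-∞` of `A ⊙ x` are replaced by `0`. -/
noncomputable def realMap {r s : ℕ} (A : TropMatrix r s) (x : Fin s → ℝ) : Fin r → ℝ :=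
  fun i => (Finset.univ.sup fun j => A i j + (x j : TropNum)).unbotD 0

/-- The tropical determinant `⨁_σ A_{1,σ(1)} ⊙ ⋯ ⊙ A_{n,σ(n)}`. -/
noncomputable def det {n : ℕ} (A : TropMatrix n n) : TropNum :=
  Finset.univ.sup fun σ : Equiv.Perm (Fin n) => ∑ i, A i (σ i)

/-- Some `k × k` minor does not vanish, i.e. is not `-∞`.  Rows and columns are chosen by
injections; the order plays no role, as the tropical determinant does not change when rows or
columns are permuted. -/
def HasMinor {r s : ℕ} (A : TropMatrix r s) (k : ℕ) : Prop :=
  ∃ (f : Fin k ↪ Fin r) (g : Fin k ↪ Fin s), det (Matrix.submatrix A f g) ≠ ⊥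

/-- The tropical rank: the largest size of a non-vanishing minor. -/
noncomputable def rank {r s : ℕ} (A : TropMatrix r s) : ℕ := sSup {k | HasMinor A k}

theorem hasMinor_iff {r s : ℕ} (A : TropMatrix r s) (k : ℕ) :
    HasMinor A k ↔ ∃ (f : Fin k ↪ Fin r) (g : Fin k ↪ Fin s), ∀ i, A (f i) (g i) ≠ ⊥ := by
  constructor
  · rintro ⟨f, g, h⟩
    have : ∃ σ : Equiv.Perm (Fin k), ∑ i, Matrix.submatrix A f g i (σ i) ≠ ⊥ := by
      by_contra hc
      push Not at hc
      exact h ((Finset.sup_eq_bot_iff _ _).2 fun σ _ => hc σ)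
    obtain ⟨σ, hσ⟩ := this
    refine ⟨f, σ.toEmbedding.trans g, fun i hi => hσ ?_⟩
    exact WithBot.sum_eq_bot_iff.2 ⟨i, Finset.mem_univ _, hi⟩
  · rintro ⟨f, g, h⟩
    refine ⟨f, g, fun hb => ?_⟩
    have := (Finset.sup_eq_bot_iff _ _).1 hb 1 (Finset.mem_univ _)
    obtain ⟨i, -, hi⟩ := WithBot.sum_eq_bot_iff.1 this
    exact h i hi

/-- `rank A = k` iff all `(k+1) × (k+1)` minors vanish and some `k × k` minor does not. -/
theorem rank_eq_iff {r s : ℕ} (A : TropMatrix r s) (k : ℕ) :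
    rank A = k ↔ ¬ HasMinor A (k + 1) ∧ HasMinor A k := by
  have hbdd : BddAbove {k | HasMinor A k} := by
    refine ⟨r, ?_⟩
    rintro k ⟨f, -⟩
    simpa using Fintype.card_le_of_embedding f
  have hne : {k | HasMinor A k}.Nonempty :=
    ⟨0, (hasMinor_iff A 0).2 ⟨⟨Fin.elim0, fun i => i.elim0⟩, ⟨Fin.elim0, fun i => i.elim0⟩,
      fun i => i.elim0⟩⟩
  have hmono : ∀ {a b : ℕ}, a ≤ b → HasMinor A b → HasMinor A a := by
    intro a b hab hb
    obtain ⟨f, g, h⟩ := (hasMinor_iff A b).1 hb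
    exact (hasMinor_iff A a).2 ⟨(Fin.castLEEmb hab).trans f, (Fin.castLEEmb hab).trans g,
      fun i => h _⟩
  constructor
  · rintro rfl
    refine ⟨fun h => ?_, Nat.sSup_mem hne hbdd⟩
    have := le_csSup hbdd h
    change sSup {k | HasMinor A k} + 1 ≤ sSup {k | HasMinor A k} at this
    omega
  · rintro ⟨h1, h2⟩
    refine le_antisymm (csSup_le hne fun b hb => ?_) (le_csSup hbdd h2)
    by_contra hlt
    exact h1 (hmono (by omega) hb)

end TropMatrix

/-! ## Integer affine linear maps -/

/-- `g ∘ f⁻¹` is integer affine linear on `f(S)`: it is `x ↦ M x + c` with an integer matrix `M`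
and a real vector `c`. -/
def IntAffineOn {T : Type*} {a b : ℕ} (S : Set T) (f : T → Fin a → ℝ) (g : T → Fin b → ℝ) :
    Prop :=
  ∃ (M : Matrix (Fin b) (Fin a) ℤ) (c : Fin b → ℝ),
    ∀ x ∈ S, ∀ i, g x i = ∑ j, (M i j : ℝ) * f x j + c i

/-- `φ ∘ f⁻¹` is locally integer affine linear on `f(S)`. -/
def LocIntAffineOn {T : Type*} [TopologicalSpace T] {a : ℕ} (S : Set T) (f : T → Fin a → ℝ)
    (φ : T → ℝ) : Prop :=
  ∀ x ∈ S, ∃ V ∈ 𝓝 x, IntAffineOn (V ∩ S) f (fun y (_ : Fin 1) => φ y)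

/-! ## Tropical fans -/

/-- Polyhedra in `ℝ^m` with rational slopes. -/
def IsRationalPolyhedron {m : ℕ} (P : Set (Fin m → ℝ)) : Prop :=
  ∃ (k : ℕ) (A : Matrix (Fin k) (Fin m) ℤ) (b : Fin k → ℝ),
    P = {x | ∀ i, b i ≤ ∑ j, (A i j : ℝ) * x j}

/-- Rational polyhedral cones in `ℝ^m` (they may contain lines). -/
def IsRationalCone {m : ℕ} (P : Set (Fin m → ℝ)) : Prop :=
  ∃ (k : ℕ) (A : Matrix (Fin k) (Fin m) ℤ), P = {x | ∀ i, 0 ≤ ∑ j, (A i j : ℝ) * x j}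

/-- `d` is a face of the rational cone `c`. -/
def IsConeFace {m : ℕ} (d c : Set (Fin m → ℝ)) : Prop :=
  ∃ u : Fin m → ℤ, (∀ x ∈ c, 0 ≤ ∑ j, (u j : ℝ) * x j) ∧
    d = {x ∈ c | ∑ j, (u j : ℝ) * x j = 0}

/-- The dimension of the linear span. -/
noncomputable def coneDim {m : ℕ} (c : Set (Fin m → ℝ)) : ℕ :=
  Module.finrank ℝ (Submodule.span ℝ c)

/-- `v` represents the primitive normal vector of the cone `σ` relative to its face `τ` of
codimension one: it is an integer vector, it generates the lattice of `span σ` modulo that of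
`span τ`, and it points from `τ` to the side of `σ`. -/
def IsPrimitiveNormal {m : ℕ} (τ σ : Set (Fin m → ℝ)) (v : Fin m → ℤ) : Prop :=
  (∃ t ∈ Submodule.span ℝ τ, (fun i => (v i : ℝ)) + t ∈ σ) ∧
    ∀ w : Fin m → ℤ, (fun i => (w i : ℝ)) ∈ Submodule.span ℝ σ →
      ∃ k : ℤ, (fun i => ((w i - k * v i : ℤ) : ℝ)) ∈ Submodule.span ℝ τ

/-- A tropical fan of dimension `n` in `ℝ^m`: a weighted rational fan of pure dimension `n` that
is balanced.  The values of `weight` matter only on the cones of dimension `n`. -/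
structure TropicalFan (m n : ℕ) where
  cones : Set (Set (Fin m → ℝ))
  finite : cones.Finite
  isCone : ∀ c ∈ cones, IsRationalCone c
  face_mem : ∀ c ∈ cones, ∀ d, IsConeFace d c → d ∈ cones
  inter_face : ∀ c ∈ cones, ∀ d ∈ cones, IsConeFace (c ∩ d) c
  pure : ∀ c, Maximal (· ∈ cones) c → coneDim c = n
  weight : Set (Fin m → ℝ) → ℤ
  balanced : ∀ τ ∈ cones, coneDim τ + 1 = n → ∀ v : Set (Fin m → ℝ) → Fin m → ℤ,
    (∀ σ ∈ {σ ∈ cones | τ ⊂ σ ∧ coneDim σ = n}, IsPrimitiveNormal τ σ (v σ)) →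
      (∑ᶠ σ ∈ {σ ∈ cones | τ ⊂ σ ∧ coneDim σ = n}, (weight σ : ℝ) • fun i => (v σ i : ℝ))
        ∈ Submodule.span ℝ τ

/-- An open tropical fan `F = {c ∩ U | c ∈ fan}`, with `U` an open neighbourhood of the origin of
some `ℝ^m`. -/
structure OpenFan (n : ℕ) where
  ambient : ℕ
  fan : TropicalFan ambient n
  nhd : Set (Fin ambient → ℝ)
  isOpen : IsOpen nhd
  zero_mem : 0 ∈ nhd

/-- The support `|F|`. -/
def OpenFan.support {n : ℕ} (F : OpenFan n) : Set (Fin F.ambient → ℝ) := ⋃₀ F.fan.cones ∩ F.nhd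

/-! ## Abstract polyhedral complexes

All complexes are sets of subsets of a topological space `T`, and `|X|` is the union of the cells,
with the subspace topology.  Charts and weights are total functions, of which only the values on
the relevant cells (and the relevant points) are ever used. -/

/-- An abstract polyhedral complex. -/
structure PolyhedralComplex (T : Type*) [TopologicalSpace T] where
  cells : Set (Set T)
  finite : cells.Finite
  /-- the dimension of a cell -/
  dim : Set T → ℕ
  /-- the embedding of a cell in `ℝ^dim` -/
  chart : (σ : Set T) → T → Fin (dim σ) → ℝ
  isClosed : ∀ σ ∈ cells, ∃ K, IsClosed K ∧ σ = K ∩ ⋃₀ cells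
  isEmbedding : ∀ σ ∈ cells, IsEmbedding (σ.domRestrict (chart σ))
  inter_mem : ∀ σ ∈ cells, ∀ τ ∈ cells, (σ ∩ τ).Nonempty → σ ∩ τ ∈ cells
  polyhedron : ∀ σ ∈ cells, IsRationalPolyhedron (chart σ '' σ)
  full : ∀ σ ∈ cells, affineSpan ℝ (chart σ '' σ) = ⊤
  intAffine : ∀ σ ∈ cells, ∀ τ ∈ cells, IntAffineOn (σ ∩ τ) (chart σ) (chart τ)
  /-- `|X|` is the disjoint union of the relative interiors of the cells -/
  partition : ∀ x ∈ ⋃₀ cells,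
    ∃! σ, σ ∈ cells ∧ x ∈ σ ∧ chart σ x ∈ interior (chart σ '' σ)

namespace PolyhedralComplex

variable {T : Type*} [TopologicalSpace T]

/-- The relative interior of a cell. -/
def relInt (X : PolyhedralComplex T) (σ : Set T) : Set T :=
  {x ∈ σ | X.chart σ x ∈ interior (X.chart σ '' σ)}

/-- The cells in `A` of `X` form a subcomplex of the cells in `B` of `Y`: every cell in `A` is
contained in one in `B`, and the integer linear structures are compatible. -/
def SubOn (X : PolyhedralComplex T) (A : Set (Set T)) (Y : PolyhedralComplex T)
    (B : Set (Set T)) : Prop :=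
  ⋃₀ A ⊆ ⋃₀ B ∧ (∀ σ ∈ A, ∃ τ ∈ B, σ ⊆ τ) ∧
    ∀ σ ∈ A, ∀ τ ∈ B, σ ⊆ τ →
      IntAffineOn σ (X.chart σ) (Y.chart τ) ∧ IntAffineOn σ (Y.chart τ) (X.chart σ)

/-- `X ⊴ Y`: `X` is a subcomplex of `Y`. -/
def IsSubcomplex (X Y : PolyhedralComplex T) : Prop := X.SubOn X.cells Y Y.cells

end PolyhedralComplex

/-- The smallest member of `B` that contains `σ` (for `B` closed under non-empty intersections). -/
def minCell {T : Type*} (B : Set (Set T)) (σ : Set T) : Set T := ⋂₀ {τ ∈ B | σ ⊆ τ}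

/-- A weighted polyhedral complex of pure dimension `n`. -/
structure WeightedComplex (T : Type*) [TopologicalSpace T] (n : ℕ) extends
    PolyhedralComplex T where
  pure : ∀ σ, Maximal (· ∈ cells) σ → dim σ = n
  /-- the weights of the cells of dimension `n` -/
  weight : Set T → ℤ

namespace WeightedComplex

variable {T : Type*} [TopologicalSpace T] {n : ℕ}

/-- The cells of the non-zero part `X*`. -/
def star (X : WeightedComplex T n) : Set (Set T) :=
  {τ ∈ X.cells | ∃ σ ∈ X.cells, X.dim σ = n ∧ X.weight σ ≠ 0 ∧ τ ⊆ σ}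

/-- `X` is reduced if it equals its non-zero part. -/
def IsReduced (X : WeightedComplex T n) : Prop := X.star = X.cells

/-- The open star `S_σ` of a cell `σ` in `X*`. -/
def openStar (X : WeightedComplex T n) (σ : Set T) : Set T :=
  {x | ∃ σ' ∈ X.star, σ ⊆ σ' ∧ x ∈ X.relInt σ'}

end WeightedComplex

/-- A tropical polyhedral complex of dimension `n`: every cell `σ` of `X*` carries a homeomorphism
`fanChart σ` from `S_σ` to the support of an open tropical fan. -/
structure TropicalComplex (T : Type*) [TopologicalSpace T] (n : ℕ) extends
    WeightedComplex T n where
  fan : Set T → OpenFan n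
  fanChart : (σ : Set T) → T → Fin (fan σ).ambient → ℝ
  fanChart_isEmbedding : ∀ σ ∈ toWeightedComplex.star,
    IsEmbedding ((toWeightedComplex.openStar σ).domRestrict (fanChart σ))
  fanChart_image : ∀ σ ∈ toWeightedComplex.star,
    fanChart σ '' toWeightedComplex.openStar σ = (fan σ).support
  fanChart_mem : ∀ σ ∈ toWeightedComplex.star, ∀ σ' ∈ toWeightedComplex.star, σ ⊆ σ' →
    ∃ c ∈ (fan σ).fan.cones,
      fanChart σ '' (σ' ∩ toWeightedComplex.openStar σ) = c ∩ (fan σ).nhd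
  fanChart_intAffine : ∀ σ ∈ toWeightedComplex.star, ∀ σ' ∈ toWeightedComplex.star, σ ⊆ σ' →
    IntAffineOn (σ' ∩ toWeightedComplex.openStar σ) (chart σ') (fanChart σ) ∧
    IntAffineOn (σ' ∩ toWeightedComplex.openStar σ) (fanChart σ) (chart σ')
  fan_weight : ∀ σ ∈ toWeightedComplex.star, ∀ σ' ∈ toWeightedComplex.star, σ ⊆ σ' →
    dim σ' = n → ∀ c ∈ (fan σ).fan.cones,
      fanChart σ '' (σ' ∩ toWeightedComplex.openStar σ) = c ∩ (fan σ).nhd →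
        (fan σ).fan.weight c = weight σ'
  fanChart_compat : ∀ σ ∈ toWeightedComplex.star, ∀ τ ∈ toWeightedComplex.star,
    IntAffineOn (toWeightedComplex.openStar σ ∩ toWeightedComplex.openStar τ)
      (fanChart σ) (fanChart τ)

/-- The tropical structures of `Z` and `X` agree along the map `τ ↦ minCell B τ` from the cells
of `Z*` to a set `B` of cells of `X`. -/
def TropicalComplex.AgreeOn {T : Type*} [TopologicalSpace T] {k n : ℕ} (Z : TropicalComplex T k)
    (X : TropicalComplex T n) (B : Set (Set T)) : Prop :=
  ∀ τ ∈ Z.star,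
    IntAffineOn (Z.openStar τ ∩ X.openStar (minCell B τ)) (Z.fanChart τ)
      (X.fanChart (minCell B τ)) ∧
    IntAffineOn (Z.openStar τ ∩ X.openStar (minCell B τ)) (X.fanChart (minCell B τ))
      (Z.fanChart τ)

/-- `R` is a refinement of `X`. -/
structure TropicalComplex.Refines {T : Type*} [TopologicalSpace T] {n : ℕ}
    (R X : TropicalComplex T n) : Prop where
  sub : R.SubOn R.star X.toPolyhedralComplex X.star
  support_eq : ⋃₀ R.star = ⋃₀ X.star
  weight_eq : ∀ σ ∈ R.star, R.dim σ = n → R.weight σ = X.weight (minCell X.star σ)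
  agree : R.AgreeOn X X.star

/-! ## Tropical cycles -/

/-- A tropical `n`-cycle (in the space `T`): a class of tropical polyhedral complexes for the
equivalence relation generated by having a common refinement. -/
def TropicalCycle (T : Type*) [TopologicalSpace T] (n : ℕ) : Type _ :=
  Quot fun X Y : TropicalComplex T n => ∃ R : TropicalComplex T n, R.Refines X ∧ R.Refines Y

namespace TropicalCycle

variable {T : Type*} [TopologicalSpace T]

/-- The cycle represented by a tropical polyhedral complex. -/
def mk {n : ℕ} (X : TropicalComplex T n) : TropicalCycle T n := Quot.mk _ X

/-- The support `|C| = |X*|`, for any representative `X` of `C`. -/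
def support {n : ℕ} (C : TropicalCycle T n) : Set T :=
  Quot.lift (fun X : TropicalComplex T n => ⋃₀ X.star)
    (fun _ _ ⟨_, h, h'⟩ => h.support_eq.symm.trans h'.support_eq) C

/-- `D` is a subcycle of `C`. -/
def IsSubcycle {k n : ℕ} (D : TropicalCycle T k) (C : TropicalCycle T n) : Prop :=
  ∃ (Z : TropicalComplex T k) (X : TropicalComplex T n), mk Z = D ∧ mk X = C ∧ X.IsReduced ∧
    Z.IsSubcomplex X.toPolyhedralComplex ∧ Z.AgreeOn X X.cells

/-- `D` is a subcycle of `C` of the same dimension, with the weights of `C`. -/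
def IsWeightedSubcycle {n : ℕ} (D C : TropicalCycle T n) : Prop :=
  ∃ Z X : TropicalComplex T n, mk Z = D ∧ mk X = C ∧ X.IsReduced ∧
    Z.IsSubcomplex X.toPolyhedralComplex ∧ Z.AgreeOn X X.cells ∧
    ∀ τ ∈ Z.cells, Z.dim τ = n → Z.weight τ = X.weight (minCell X.cells τ)

/-- `φ` is a regular invertible function on the open subset `U` of `|C|`. -/
def IsRegularInvertible {n : ℕ} (C : TropicalCycle T n) (U : Set T) (φ : T → ℝ) : Prop :=
  ContinuousOn φ U ∧ ∃ X : TropicalComplex T n, mk X = C ∧ ∀ σ ∈ X.star,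
    LocIntAffineOn (U ∩ σ) (X.chart σ) φ ∧ LocIntAffineOn (U ∩ X.openStar σ) (X.fanChart σ) φ

/-- The map `f : |C| → |D|` is a morphism of tropical cycles.  (The values of `f` outside `|C|`
play no role.) -/
def IsMorphism {T' : Type*} [TopologicalSpace T'] {n m : ℕ} (C : TropicalCycle T n)
    (D : TropicalCycle T' m) (f : T → T') : Prop :=
  ContinuousOn f C.support ∧ MapsTo f C.support D.support ∧
  ∃ (X : TropicalComplex T n) (Y : TropicalComplex T' m),
    mk X = C ∧ mk Y = D ∧ X.IsReduced ∧ Y.IsReduced ∧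
    (∀ σ ∈ X.cells, ∃ τ ∈ Y.cells, f '' σ ⊆ τ) ∧
    ∀ σ ∈ X.cells, ∀ τ ∈ Y.cells, f '' σ ⊆ τ →
      IntAffineOn (X.openStar σ ∩ f ⁻¹' Y.openStar τ) (X.fanChart σ) (fun x => Y.fanChart τ (f x))

/-- On `U`, every entry of the matrix-valued function `M` is either a regular invertible function
or constantly `-∞`. -/
def HasRegularEntries {n a b : ℕ} (C : TropicalCycle T n) (U : Set T) (M : T → TropMatrix a b) :
    Prop :=
  ∀ i j, (∃ g : T → ℝ, C.IsRegularInvertible U g ∧ ∀ x ∈ U, M x i j = (g x : TropNum)) ∨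
    ∀ x ∈ U, M x i j = ⊥

end TropicalCycle

/-! ## Tropical vector bundles -/

section Bundles

variable {T E : Type*} [TopologicalSpace T] [TopologicalSpace E] {n m : ℕ}

/-- `U` is open in `|C|`, and `Φ` is a homeomorphism `π⁻¹(U) → U × ℝ^r` over `U` whose components
in `ℝ^r` are regular invertible functions.  (Here `π : |F| → |C|`.) -/
structure IsTrivialization (C : TropicalCycle T n) (F : TropicalCycle E m) (π : E → T) {r : ℕ}
    (U : Set T) (Φ : E → T × (Fin r → ℝ)) : Prop where
  isOpen : ∃ O, IsOpen O ∧ U = O ∩ C.support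
  isEmbedding : IsEmbedding ((F.support ∩ π ⁻¹' U).domRestrict Φ)
  image : Φ '' (F.support ∩ π ⁻¹' U) = U ×ˢ univ
  proj : ∀ y ∈ F.support ∩ π ⁻¹' U, (Φ y).1 = π y
  regular : ∀ j, F.IsRegularInvertible (F.support ∩ π ⁻¹' U) fun y => (Φ y).2 j

/-- `Ψ ∘ Φ⁻¹` is `(x, a) ↦ (x, f_{M(x)}(a))` over `U ∩ V` for a transition map `M` to `G(r)` whose
entries are regular invertible or constantly `-∞`. -/
def HasTransition (C : TropicalCycle T n) (F : TropicalCycle E m) (π : E → T) {r : ℕ}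
    (U : Set T) (Φ : E → T × (Fin r → ℝ)) (V : Set T) (Ψ : E → T × (Fin r → ℝ)) : Prop :=
  ∃ M : T → TropMatrix r r, (∀ x ∈ U ∩ V, (M x).IsInvertible) ∧
    C.HasRegularEntries (U ∩ V) M ∧
    ∀ y ∈ F.support, π y ∈ U ∩ V → (Ψ y).2 = (M (π y)).realMap (Φ y).2

end Bundles

/-- A tropical vector bundle of rank `r` over the cycle `C`, with total space in `E`. -/
structure TropicalVectorBundle {T : Type*} [TopologicalSpace T] {n : ℕ} (C : TropicalCycle T n)
    (r : ℕ) (E : Type*) [TopologicalSpace E] where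
  total : TropicalCycle E (n + r)
  proj : E → T
  isMorphism : total.IsMorphism C proj
  /-- the number of sets in the open covering -/
  size : ℕ
  base : Fin size → Set T
  triv : Fin size → E → T × (Fin r → ℝ)
  cover : ⋃ i, base i = C.support
  isTrivialization : ∀ i, IsTrivialization C total proj (base i) (triv i)
  transition : ∀ i j, HasTransition C total proj (base i) (triv i) (base j) (triv j)
  /-- there are representatives `F₀` and `X₀` with `F₀ = {π⁻¹(τ) | τ ∈ X₀}` and the same weights -/
  product : ∃ (F₀ : TropicalComplex E (n + r)) (X₀ : TropicalComplex T n),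
    TropicalCycle.mk F₀ = total ∧ TropicalCycle.mk X₀ = C ∧
    F₀.cells = {ρ | ∃ τ ∈ X₀.cells, ρ = total.support ∩ proj ⁻¹' τ} ∧
    ∀ τ, Maximal (· ∈ X₀.cells) τ → F₀.weight (total.support ∩ proj ⁻¹' τ) = X₀.weight τ

/-- `(U, Φ)` is a local trivialization of the bundle: it can be added to the given ones. -/
def TropicalVectorBundle.IsLocalTriv {T : Type*} [TopologicalSpace T] {n : ℕ}
    {C : TropicalCycle T n} {r : ℕ} {E : Type*} [TopologicalSpace E]
    (B : TropicalVectorBundle C r E) (U : Set T) (Φ : E → T × (Fin r → ℝ)) : Prop :=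
  IsTrivialization C B.total B.proj U Φ ∧
    ∀ i, HasTransition C B.total B.proj (B.base i) (B.triv i) U Φ ∧
      HasTransition C B.total B.proj U Φ (B.base i) (B.triv i)

section Morphisms

variable {T E F : Type*} [TopologicalSpace T] [TopologicalSpace E] [TopologicalSpace F] {n : ℕ}
  {C : TropicalCycle T n} {e f : ℕ}

/-- `U` carries local trivializations `Φ`, `Ψ` of both bundles, in which the map `φ` is
`(x, a) ↦ (x, f_{A(x)}(a))` with `A` taking values in `G(f × e)` and entries that are regular
invertible or constantly `-∞`. -/
structure IsLocalMatrix (B : TropicalVectorBundle C e E) (B' : TropicalVectorBundle C f F)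
    (φ : E → F) (U : Set T) (Φ : E → T × (Fin e → ℝ)) (Ψ : F → T × (Fin f → ℝ))
    (A : T → TropMatrix f e) : Prop where
  source : B.IsLocalTriv U Φ
  target : B'.IsLocalTriv U Ψ
  rowSparse : ∀ x ∈ U, (A x).IsRowSparse
  regular : C.HasRegularEntries U A
  formula : ∀ y ∈ B.total.support, B.proj y ∈ U → (Ψ (φ y)).2 = (A (B.proj y)).realMap (Φ y).2

/-- A morphism of tropical vector bundles over `C`. -/
structure TropicalBundleHom (B : TropicalVectorBundle C e E) (B' : TropicalVectorBundle C f F)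
    where
  toFun : E → F
  isMorphism : B.total.IsMorphism B'.total toFun
  comm : ∀ y ∈ B.total.support, B'.proj (toFun y) = B.proj y
  exists_local : ∃ (s : ℕ) (U : Fin s → Set T) (Φ : Fin s → E → T × (Fin e → ℝ))
    (Ψ : Fin s → F → T × (Fin f → ℝ)) (A : Fin s → T → TropMatrix f e),
    ⋃ i, U i = C.support ∧ ∀ i, IsLocalMatrix B B' toFun (U i) (Φ i) (Ψ i) (A i)

namespace TropicalBundleHom

variable {B : TropicalVectorBundle C e E} {B' : TropicalVectorBundle C f F}

/-- `M ∈ G(f × e)` is the matrix of the stalk map `φ_p : 𝕋^e → 𝕋^f` in some local trivializations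
near `p`. -/
def IsStalkMatrix (φ : TropicalBundleHom B B') (p : T) (M : TropMatrix f e) : Prop :=
  ∃ U Φ Ψ A, IsLocalMatrix B B' φ.toFun U Φ Ψ A ∧ p ∈ U ∧ A p = M

/-- The degeneracy locus `D_k(φ) = {p ∈ |C| | troprank φ_p ≤ k}`. -/
def degeneracyLocus (φ : TropicalBundleHom B B') (k : ℕ) : Set T :=
  {p ∈ C.support | ∃ M, φ.IsStalkMatrix p M ∧ M.rank ≤ k}

end TropicalBundleHom

end Morphisms

/-!
The rank of a row-sparse tropical matrix `A` is the number of columns that contain a finite entry,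
and these columns are the coordinates on which `f_A` really depends
(`TropMatrix.IsRowSparse.rank_eq_ncard_essentialCoords`).  An invertible matrix acts by a
permutation of the coordinates followed by a translation, so the number of essential coordinates
does not change under a change of trivializations; hence the rank of the stalk map at `p` is well
defined (`TropicalBundleHom.IsStalkMatrix.rank_eq`).

Over a set `U` that carries trivializations, each entry of the matrix is finite everywhere or `-∞`
everywhere, and the rank depends only on the positions of the finite entries.  The rank is therefore
constant on `U`, and the degeneracy locus is open and closed in `|X|`
(`TropicalBundleHom.isClopen_degeneracyLocus`).  It thus contains every preconnected subset of `|X|`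
that it meets; this gives the connected components, and also the cells of a representative, since
these are homeomorphic to polyhedra.

It remains to cut a reduced representative of `X` down to the cells inside such a set `S`
(`TropicalComplex.restrict`).  A cell that meets a cell inside `S` lies itself in `S`, so the open
stars of the remaining cells are the old ones, and all fan charts and weights can be kept.
-/

/-! ### The rank of a row-sparse matrix -/

/-- The coordinates on which a function on `ℝ^s` really depends. -/
def essentialCoords {s : ℕ} {β : Type*} (g : (Fin s → ℝ) → β) : Set (Fin s) :=
  {j | ∃ x t, g (Function.update x j t) ≠ g x}

theorem essentialCoords_comp_left {s : ℕ} {β γ : Type*} {h : β → γ} (hh : Function.Injective h)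
    (g : (Fin s → ℝ) → β) : essentialCoords (h ∘ g) = essentialCoords g := by
  simp [essentialCoords, hh.eq_iff]

namespace TropMatrix

theorem hasMinor_congr {r s : ℕ} {A B : TropMatrix r s} (h : ∀ i j, A i j = ⊥ ↔ B i j = ⊥)
    (k : ℕ) : HasMinor A k ↔ HasMinor B k := by
  simp only [hasMinor_iff, ne_eq, h]

/-- The rank depends only on the positions of the finite entries. -/
theorem rank_congr {r s : ℕ} {A B : TropMatrix r s} (h : ∀ i j, A i j = ⊥ ↔ B i j = ⊥) :
    rank A = rank B := by
  simp only [rank, hasMinor_congr h]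

/-- The columns that contain a finite entry. -/
def finiteCols {r s : ℕ} (A : TropMatrix r s) : Set (Fin s) := {j | ∃ i, A i j ≠ ⊥}

theorem IsRowSparse.hasMinor_iff_le_ncard {r s : ℕ} {A : TropMatrix r s} (hA : A.IsRowSparse)
    (k : ℕ) : HasMinor A k ↔ k ≤ A.finiteCols.ncard := by
  rw [hasMinor_iff]
  constructor
  · rintro ⟨f, g, h⟩
    have hsub : range g ⊆ A.finiteCols := by
      rintro _ ⟨i, rfl⟩
      exact ⟨f i, h i⟩
    have hcard : (range g).ncard = k := by
      rw [← image_univ, ncard_image_of_injective _ g.injective, ncard_univ, Nat.card_fin]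
    exact hcard ▸ ncard_le_ncard hsub (toFinite _)
  · intro hk
    have hk' : Fintype.card (Fin k) ≤ Nat.card A.finiteCols := by
      simpa [Nat.card_coe_set_eq] using hk
    have := Fintype.ofFinite A.finiteCols
    rw [Nat.card_eq_fintype_card] at hk'
    obtain ⟨g⟩ := Function.Embedding.nonempty_of_card_le hk'
    choose f hf using fun i => (g i).2
    -- Rows chosen for different columns are different, as each row has only one finite entry.
    refine ⟨⟨f, fun a b hab => ?_⟩, g.trans (Function.Embedding.subtype _), hf⟩
    exact g.injective (Subtype.ext (hA (f a) _ _ (hf a) (hab ▸ hf b)))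

theorem IsRowSparse.rank_eq_ncard {r s : ℕ} {A : TropMatrix r s} (hA : A.IsRowSparse) :
    rank A = A.finiteCols.ncard := by
  have : {k | HasMinor A k} = Iic A.finiteCols.ncard := by
    ext k
    exact hA.hasMinor_iff_le_ncard k
  rw [rank, this, csSup_Iic]

theorem IsRowSparse.realMap_apply {r s : ℕ} {A : TropMatrix r s} (hA : A.IsRowSparse)
    {i : Fin r} {j : Fin s} (h : A i j ≠ ⊥) (x : Fin s → ℝ) :
    A.realMap x i = (A i j).unbotD 0 + x j := by
  have hsup : (Finset.univ.sup fun j' => A i j' + (x j' : TropNum)) = A i j + (x j : TropNum) := by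
    refine le_antisymm (Finset.sup_le fun j' _ => ?_)
      (Finset.le_sup (f := fun j' => A i j' + (x j' : TropNum)) (Finset.mem_univ j))
    by_cases hj : A i j' = ⊥
    · simp [hj]
    · rw [hA i j' j hj h]
  rw [realMap, hsup]
  lift A i j to ℝ using h with a
  rfl

theorem realMap_update_of_notMem {r s : ℕ} {A : TropMatrix r s} {j : Fin s}
    (h : j ∉ A.finiteCols) (x : Fin s → ℝ) (t : ℝ) :
    A.realMap (Function.update x j t) = A.realMap x := by
  have h' : ∀ i, A i j = ⊥ := fun i => not_not.1 fun hi => h ⟨i, hi⟩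
  funext i
  unfold realMap
  congr 2
  funext j'
  by_cases hj : j' = j
  · subst hj
    simp [h']
  · simp [hj]

theorem IsRowSparse.essentialCoords_realMap {r s : ℕ} {A : TropMatrix r s}
    (hA : A.IsRowSparse) : essentialCoords A.realMap = A.finiteCols := by
  ext j
  constructor
  · rintro ⟨x, t, h⟩
    by_contra hj
    exact h (realMap_update_of_notMem hj x t)
  · rintro ⟨i, hi⟩
    refine ⟨0, 1, fun h => ?_⟩
    have := congrFun h i
    simp [hA.realMap_apply hi] at this

/-- The rank can be read off from the map `f_A`. -/
theorem IsRowSparse.rank_eq_ncard_essentialCoords {r s : ℕ} {A : TropMatrix r s}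
    (hA : A.IsRowSparse) : rank A = (essentialCoords A.realMap).ncard := by
  rw [hA.essentialCoords_realMap, hA.rank_eq_ncard]

/-! ### Invertible matrices -/

/-- For invertible `G`, the map `f_G` is a permutation of the coordinates followed by a
translation. -/
theorem IsInvertible.exists_perm {r : ℕ} {G : TropMatrix r r} (hG : G.IsInvertible) :
    ∃ (ρ : Equiv.Perm (Fin r)) (c : Fin r → ℝ), ∀ x i, G.realMap x i = c i + x (ρ i) := by
  have hs : G.IsRowSparse := fun i j j' h h' => (hG.1 i).unique h h'
  choose ρ hρ using fun i => (hG.1 i).exists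
  have hinj : Function.Injective ρ := fun a b hab =>
    (hG.2 (ρ a)).unique (hρ a) (hab ▸ hρ b)
  exact ⟨Equiv.ofBijective ρ (Finite.injective_iff_bijective.1 hinj),
    fun i => (G i (ρ i)).unbotD 0, fun x i => hs.realMap_apply (hρ i) x⟩

theorem IsInvertible.realMap_injective {r : ℕ} {G : TropMatrix r r} (hG : G.IsInvertible) :
    Function.Injective G.realMap := by
  obtain ⟨ρ, c, h⟩ := hG.exists_perm
  intro x y hxy
  funext j
  have := congrFun hxy (ρ.symm j)
  simpa [h] using this

theorem IsInvertible.ncard_essentialCoords_comp {r : ℕ} {G : TropMatrix r r}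
    (hG : G.IsInvertible) {β : Type*} (g : (Fin r → ℝ) → β) :
    (essentialCoords (g ∘ G.realMap)).ncard = (essentialCoords g).ncard := by
  obtain ⟨ρ, c, h⟩ := hG.exists_perm
  have hup : ∀ x i t, G.realMap (Function.update x (ρ i) t) =
      Function.update (G.realMap x) i (c i + t) := by
    intro x i t
    funext i'
    rcases eq_or_ne i' i with rfl | hi
    · simp [h]
    · simp [h, hi]
  have himage : essentialCoords (g ∘ G.realMap) = ρ '' essentialCoords g := by
    ext j
    obtain ⟨i, rfl⟩ := ρ.surjective j
    rw [ρ.injective.mem_set_image]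
    constructor
    · rintro ⟨x, t, hx⟩
      exact ⟨G.realMap x, c i + t, by simpa [hup] using hx⟩
    · rintro ⟨y, t, hy⟩
      have hsurj : G.realMap (fun j => y (ρ.symm j) - c (ρ.symm j)) = y := by
        funext i'
        simp [h]
      refine ⟨fun j => y (ρ.symm j) - c (ρ.symm j), t - c i, ?_⟩
      simpa [hup, hsurj] using hy
  rw [himage, ncard_image_of_injective _ ρ.injective]

end TropMatrix

/-! ### The rank of the stalk maps -/

section Trivializations

variable {T E : Type*} [TopologicalSpace T] [TopologicalSpace E] {n m : ℕ}

theorem IsTrivialization.subset {C : TropicalCycle T n} {F : TropicalCycle E m} {π : E → T}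
    {r : ℕ} {U : Set T} {Φ : E → T × (Fin r → ℝ)} (h : IsTrivialization C F π U Φ) :
    U ⊆ C.support := by
  obtain ⟨O, -, rfl⟩ := h.isOpen
  exact inter_subset_right

/-- The fibre over a point of `U` is mapped onto `ℝ^r`. -/
theorem IsTrivialization.exists_of_mem {C : TropicalCycle T n} {F : TropicalCycle E m}
    {π : E → T} {r : ℕ} {U : Set T} {Φ : E → T × (Fin r → ℝ)} (h : IsTrivialization C F π U Φ)
    {p : T} (hp : p ∈ U) (a : Fin r → ℝ) : ∃ y ∈ F.support, π y = p ∧ (Φ y).2 = a := by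
  have hmem : (p, a) ∈ Φ '' (F.support ∩ π ⁻¹' U) := h.image ▸ ⟨hp, mem_univ _⟩
  obtain ⟨y, hy, hya⟩ := hmem
  exact ⟨y, hy.1, by rw [← h.proj y hy, hya], by rw [hya]⟩

/-- At a point of both domains, two local trivializations of a bundle differ by two successive
invertible maps, one into and one out of a trivialization of the given covering. -/
theorem TropicalVectorBundle.IsLocalTriv.exists_transition {C : TropicalCycle T n} {r : ℕ}
    {B : TropicalVectorBundle C r E} {U U' : Set T} {Φ Φ' : E → T × (Fin r → ℝ)}
    (h : B.IsLocalTriv U Φ) (h' : B.IsLocalTriv U' Φ') {p : T} (hp : p ∈ U) (hp' : p ∈ U') :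
    ∃ G G' : TropMatrix r r, G.IsInvertible ∧ G'.IsInvertible ∧
      ∀ y ∈ B.total.support, B.proj y = p → (Φ' y).2 = G'.realMap (G.realMap (Φ y).2) := by
  obtain ⟨i, hi⟩ := mem_iUnion.1 (B.cover.symm ▸ h.1.subset hp : p ∈ ⋃ i, B.base i)
  obtain ⟨M, hM, -, hMy⟩ := (h.2 i).2
  obtain ⟨M', hM', -, hMy'⟩ := (h'.2 i).1
  refine ⟨M p, M' p, hM p ⟨hp, hi⟩, hM' p ⟨hi, hp'⟩, ?_⟩
  rintro y hy rfl
  rw [hMy' y hy ⟨hi, hp'⟩, hMy y hy ⟨hp, hi⟩]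

end Trivializations

theorem TropicalCycle.HasRegularEntries.eq_bot_iff {T : Type*} [TopologicalSpace T]
    {n a b : ℕ} {C : TropicalCycle T n} {U : Set T} {M : T → TropMatrix a b}
    (h : C.HasRegularEntries U M) {p q : T} (hp : p ∈ U) (hq : q ∈ U) (i : Fin a) (j : Fin b) :
    M p i j = ⊥ ↔ M q i j = ⊥ := by
  rcases h i j with ⟨g, -, hg⟩ | hb
  · simp [hg p hp, hg q hq]
  · simp [hb p hp, hb q hq]

namespace TropicalBundleHom

variable {T E F : Type*} [TopologicalSpace T] [TopologicalSpace E] [TopologicalSpace F] {n : ℕ}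
  {C : TropicalCycle T n} {e f : ℕ} {B : TropicalVectorBundle C e E}
  {B' : TropicalVectorBundle C f F}

theorem IsStalkMatrix.mem_support {φ : TropicalBundleHom B B'} {p : T} {M : TropMatrix f e}
    (h : φ.IsStalkMatrix p M) : p ∈ C.support := by
  obtain ⟨U, Φ, Ψ, A, hA, hp, -⟩ := h
  exact hA.source.1.subset hp

/-- The rank of the stalk map does not depend on the local trivializations. -/
theorem IsStalkMatrix.rank_eq {φ : TropicalBundleHom B B'} {p : T} {M M' : TropMatrix f e}
    (h : φ.IsStalkMatrix p M) (h' : φ.IsStalkMatrix p M') : M.rank = M'.rank := by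
  obtain ⟨U, Φ, Ψ, A, hA, hp, rfl⟩ := h
  obtain ⟨U', Φ', Ψ', A', hA', hp', rfl⟩ := h'
  obtain ⟨G, G', hG, hG', hΦ⟩ := hA.source.exists_transition hA'.source hp hp'
  obtain ⟨H, H', hH, hH', hΨ⟩ := hA.target.exists_transition hA'.target hp hp'
  -- Both sides send the coordinates of a point of the fibre of the source in `Φ` to the coordinates
  -- of its image in `Ψ'`.
  have key : ((A' p).realMap ∘ G'.realMap) ∘ G.realMap =
      (H'.realMap ∘ H.realMap) ∘ (A p).realMap := by
    funext a
    obtain ⟨y, hy, rfl, rfl⟩ := hA.source.1.exists_of_mem hp a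
    simp only [Function.comp_apply]
    rw [← hΦ y hy rfl, ← hA'.formula y hy hp', ← hA.formula y hy hp]
    exact hΨ _ (φ.isMorphism.2.1 hy) (φ.comm y hy)
  rw [(hA.rowSparse p hp).rank_eq_ncard_essentialCoords,
    (hA'.rowSparse p hp').rank_eq_ncard_essentialCoords,
    ← hG'.ncard_essentialCoords_comp (A' p).realMap,
    ← hG.ncard_essentialCoords_comp (_ ∘ _), key,
    essentialCoords_comp_left (hH'.realMap_injective.comp hH.realMap_injective)]

theorem IsStalkMatrix.mem_degeneracyLocus_iff {φ : TropicalBundleHom B B'} {p : T}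
    {M : TropMatrix f e} (h : φ.IsStalkMatrix p M) (k : ℕ) :
    p ∈ φ.degeneracyLocus k ↔ M.rank ≤ k := by
  constructor
  · rintro ⟨-, M', hM', hk⟩
    exact (h.rank_eq hM').trans_le hk
  · exact fun hk => ⟨h.mem_support, M, h, hk⟩

/-- Every point of `|C|` has an open neighbourhood in which the rank of the stalk map is
constant. -/
theorem exists_isOpen_forall_mem_degeneracyLocus_iff (φ : TropicalBundleHom B B') (k : ℕ) {p : T}
    (hp : p ∈ C.support) : ∃ O, IsOpen O ∧ p ∈ O ∧
      ∀ q ∈ O ∩ C.support, q ∈ φ.degeneracyLocus k ↔ p ∈ φ.degeneracyLocus k := by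
  obtain ⟨s, U, Φ, Ψ, A, hcov, hA⟩ := φ.exists_local
  obtain ⟨i, hi⟩ := mem_iUnion.1 (hcov.symm ▸ hp : p ∈ ⋃ i, U i)
  obtain ⟨O, hO, hU⟩ := (hA i).source.1.isOpen
  refine ⟨O, hO, (hU ▸ hi : p ∈ O ∩ _).1, fun q hq => ?_⟩
  rw [← hU] at hq
  have stalk : ∀ x ∈ U i, φ.IsStalkMatrix x (A i x) := fun x hx =>
    ⟨U i, Φ i, Ψ i, A i, hA i, hx, rfl⟩
  rw [(stalk q hq).mem_degeneracyLocus_iff, (stalk p hi).mem_degeneracyLocus_iff,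
    TropMatrix.rank_congr ((hA i).regular.eq_bot_iff hq hi)]

/-- The degeneracy locus is open and closed in `|C|`. -/
theorem isClopen_degeneracyLocus (φ : TropicalBundleHom B B') (k : ℕ) :
    IsClopen ((↑) ⁻¹' φ.degeneracyLocus k : Set C.support) := by
  have hloc : ∀ p : C.support, ∀ᶠ q : C.support in 𝓝 p,
      (q : T) ∈ φ.degeneracyLocus k ↔ (p : T) ∈ φ.degeneracyLocus k := by
    intro p
    obtain ⟨O, hO, hpO, h⟩ := φ.exists_isOpen_forall_mem_degeneracyLocus_iff k p.2
    filter_upwards [(hO.preimage continuous_subtype_val).mem_nhds hpO] with q hq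
    exact h q ⟨hq, q.2⟩
  constructor
  · rw [← isOpen_compl_iff, isOpen_iff_mem_nhds]
    intro p hp
    filter_upwards [hloc p] with q hq using fun h => hp (hq.1 h)
  · rw [isOpen_iff_mem_nhds]
    intro p hp
    filter_upwards [hloc p] with q hq using hq.2 hp

end TropicalBundleHom

/-- A preconnected subset of `S` that meets a relatively clopen subset of `S` is contained in it. -/
theorem IsPreconnected.subset_of_isClopen_preimage {T : Type*} [TopologicalSpace T]
    {S D K : Set T} (hD : IsClopen ((↑) ⁻¹' D : Set S)) (hK : IsPreconnected K) (hKS : K ⊆ S)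
    (hne : (K ∩ D).Nonempty) : K ⊆ D := by
  have hK' : IsPreconnected ((↑) ⁻¹' K : Set S) := by
    rw [← IsInducing.subtypeVal.isPreconnected_image, Subtype.image_preimage_coe,
      inter_eq_right.2 hKS]
    exact hK
  obtain ⟨p, hp, hpD⟩ := hne
  have hsub := hK'.subset_isClopen hD ⟨⟨p, hKS hp⟩, hp, hpD⟩
  exact fun q hq => hsub (show (⟨q, hKS hq⟩ : S) ∈ _ from hq)

/-! ### Restricting a complex to a union of components -/

theorem IsRationalPolyhedron.convex {m : ℕ} {P : Set (Fin m → ℝ)} (h : IsRationalPolyhedron P) :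
    Convex ℝ P := by
  obtain ⟨k, A, b, rfl⟩ := h
  simp only [ofPred_forall]
  refine convex_iInter fun i => convex_halfSpace_ge ?_ _
  exact ⟨fun x y => by simp [mul_add, Finset.sum_add_distrib],
    fun c x => by simp [Finset.mul_sum, mul_left_comm]⟩

theorem IntAffineOn.refl {T : Type*} {a : ℕ} (S : Set T) (g : T → Fin a → ℝ) :
    IntAffineOn S g g :=
  ⟨1, 0, fun x _ i => by simp [Matrix.one_apply]⟩

theorem IntAffineOn.mono {T : Type*} {a b : ℕ} {S S' : Set T} {g : T → Fin a → ℝ}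
    {h : T → Fin b → ℝ} (H : IntAffineOn S g h) (hS : S' ⊆ S) : IntAffineOn S' g h := by
  obtain ⟨M, c, hM⟩ := H
  exact ⟨M, c, fun x hx => hM x (hS hx)⟩

theorem minCell_of_mem {T : Type*} {B : Set (Set T)} {σ : Set T} (h : σ ∈ B) :
    minCell B σ = σ :=
  subset_antisymm (sInter_subset_of_mem ⟨h, subset_rfl⟩) (subset_sInter fun _ hτ => hτ.2)

namespace PolyhedralComplex

variable {T : Type*} [TopologicalSpace T]

theorem nonempty_of_mem (X : PolyhedralComplex T) {σ : Set T} (h : σ ∈ X.cells) :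
    σ.Nonempty := by
  have hspan := X.full σ h
  rw [← image_nonempty (f := X.chart σ), ← affineSpan_nonempty ℝ, hspan]
  exact ⟨0, trivial⟩

theorem isPreconnected (X : PolyhedralComplex T) {σ : Set T} (h : σ ∈ X.cells) :
    IsPreconnected σ := by
  rw [isPreconnected_iff_preconnectedSpace]
  refine ⟨?_⟩
  rw [← (X.isEmbedding σ h).isInducing.isPreconnected_image, image_univ, range_domRestrict]
  exact (X.polyhedron σ h).convex.isPreconnected

/-- `S` contains every cell of `X` that it meets. -/
def Saturates (S : Set T) (X : PolyhedralComplex T) : Prop :=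
  ∀ σ ∈ X.cells, (σ ∩ S).Nonempty → σ ⊆ S

theorem Saturates.subset_of_subset {S : Set T} {X : PolyhedralComplex T} (hS : Saturates S X)
    {σ τ : Set T} (hσ : σ ∈ X.cells) (hσS : σ ⊆ S) (hτ : τ ∈ X.cells) (hστ : σ ⊆ τ) : τ ⊆ S := by
  obtain ⟨x, hx⟩ := X.nonempty_of_mem hσ
  exact hS τ hτ ⟨x, hστ hx, hσS hx⟩

/-- The complex of the cells of `X` that lie in `S`. -/
def restrict (X : PolyhedralComplex T) (S : Set T) (hS : Saturates S X) :
    PolyhedralComplex T where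
  cells := {σ ∈ X.cells | σ ⊆ S}
  finite := X.finite.subset (sep_subset _ _)
  dim := X.dim
  chart := X.chart
  isClosed := by
    rintro σ ⟨hσ, hσS⟩
    obtain ⟨K, hK, hσK⟩ := X.isClosed σ hσ
    refine ⟨K, hK, subset_antisymm
      (fun x hx => ⟨(hσK ▸ hx : x ∈ K ∩ _).1, σ, ⟨hσ, hσS⟩, hx⟩) ?_⟩
    rintro x ⟨hxK, τ, hτ, hxτ⟩
    rw [hσK]
    exact ⟨hxK, τ, hτ.1, hxτ⟩
  isEmbedding σ hσ := X.isEmbedding σ hσ.1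
  inter_mem σ hσ τ hτ h := ⟨X.inter_mem σ hσ.1 τ hτ.1 h, inter_subset_left.trans hσ.2⟩
  polyhedron σ hσ := X.polyhedron σ hσ.1
  full σ hσ := X.full σ hσ.1
  intAffine σ hσ τ hτ := X.intAffine σ hσ.1 τ hτ.1
  partition := by
    rintro x ⟨ρ, hρ, hxρ⟩
    obtain ⟨σ, ⟨hσ, hxσ, hint⟩, huniq⟩ := X.partition x ⟨ρ, hρ.1, hxρ⟩
    exact ⟨σ, ⟨⟨hσ, hS σ hσ ⟨x, hxσ, hρ.2 hxρ⟩⟩, hxσ, hint⟩,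
      fun τ hτ => huniq τ ⟨hτ.1.1, hτ.2⟩⟩

end PolyhedralComplex

namespace WeightedComplex

variable {T : Type*} [TopologicalSpace T] {n : ℕ}

/-- The complex of the cells of `X` that lie in `S`, with the weights of `X`. -/
def restrict (X : WeightedComplex T n) (S : Set T)
    (hS : PolyhedralComplex.Saturates S X.toPolyhedralComplex) : WeightedComplex T n where
  toPolyhedralComplex := X.toPolyhedralComplex.restrict S hS
  pure σ hσ := X.pure σ ⟨hσ.prop.1, fun _ hτ hστ =>
    hσ.le_of_ge ⟨hτ, hS.subset_of_subset hσ.prop.1 hσ.prop.2 hτ hστ⟩ hστ⟩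
  weight := X.weight

variable {X : WeightedComplex T n} {S : Set T}
  {hS : PolyhedralComplex.Saturates S X.toPolyhedralComplex}

theorem star_restrict : (X.restrict S hS).star = {σ ∈ X.star | σ ⊆ S} := by
  ext τ
  constructor
  · rintro ⟨⟨hτ, hτS⟩, σ, hσ, hdim, hw, hτσ⟩
    exact ⟨⟨hτ, σ, hσ.1, hdim, hw, hτσ⟩, hτS⟩
  · rintro ⟨⟨hτ, σ, hσ, hdim, hw, hτσ⟩, hτS⟩
    exact ⟨⟨hτ, hτS⟩, σ, ⟨hσ, hS.subset_of_subset hτ hτS hσ hτσ⟩, hdim, hw, hτσ⟩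

theorem openStar_restrict {σ : Set T} (hσ : σ ∈ (X.restrict S hS).star) :
    (X.restrict S hS).openStar σ = X.openStar σ := by
  rw [star_restrict] at hσ
  ext x
  constructor
  · rintro ⟨σ', hσ', hsub, hx⟩
    rw [star_restrict] at hσ'
    exact ⟨σ', hσ'.1, hsub, hx⟩
  · rintro ⟨σ', hσ', hsub, hx⟩
    refine ⟨σ', ?_, hsub, hx⟩
    rw [star_restrict]
    exact ⟨hσ', hS.subset_of_subset hσ.1.1 hσ.2 hσ'.1 hsub⟩

end WeightedComplex

namespace TropicalComplex

variable {T : Type*} [TopologicalSpace T] {n : ℕ}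

/-- The complex of the cells of `X` that lie in `S`, with the weights and the fan charts of `X`. -/
def restrict (X : TropicalComplex T n) (S : Set T)
    (hS : PolyhedralComplex.Saturates S X.toPolyhedralComplex) : TropicalComplex T n where
  toWeightedComplex := X.toWeightedComplex.restrict S hS
  fan := X.fan
  fanChart := X.fanChart
  fanChart_isEmbedding σ hσ := by
    rw [WeightedComplex.openStar_restrict hσ]
    rw [WeightedComplex.star_restrict] at hσ
    exact X.fanChart_isEmbedding σ hσ.1
  fanChart_image σ hσ := by
    rw [WeightedComplex.openStar_restrict hσ]
    rw [WeightedComplex.star_restrict] at hσ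
    exact X.fanChart_image σ hσ.1
  fanChart_mem σ hσ σ' hσ' := by
    rw [WeightedComplex.openStar_restrict hσ]
    rw [WeightedComplex.star_restrict] at hσ hσ'
    exact X.fanChart_mem σ hσ.1 σ' hσ'.1
  fanChart_intAffine σ hσ σ' hσ' := by
    rw [WeightedComplex.openStar_restrict hσ]
    rw [WeightedComplex.star_restrict] at hσ hσ'
    exact X.fanChart_intAffine σ hσ.1 σ' hσ'.1
  fan_weight σ hσ σ' hσ' := by
    rw [WeightedComplex.openStar_restrict hσ]
    rw [WeightedComplex.star_restrict] at hσ hσ'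
    exact X.fan_weight σ hσ.1 σ' hσ'.1
  fanChart_compat σ hσ τ hτ := by
    rw [WeightedComplex.openStar_restrict hσ, WeightedComplex.openStar_restrict hτ]
    rw [WeightedComplex.star_restrict] at hσ hτ
    exact X.fanChart_compat σ hσ.1 τ hτ.1

variable {X : TropicalComplex T n} {S : Set T}
  {hS : PolyhedralComplex.Saturates S X.toPolyhedralComplex}

theorem support_restrict (hSX : S ⊆ ⋃₀ X.star) : ⋃₀ (X.restrict S hS).star = S := by
  have hstar : (X.restrict S hS).star = {σ ∈ X.star | σ ⊆ S} := WeightedComplex.star_restrict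
  rw [hstar]
  refine subset_antisymm (sUnion_subset fun σ hσ => hσ.2) fun x hx => ?_
  obtain ⟨σ, hσ, hxσ⟩ := hSX hx
  exact ⟨σ, ⟨hσ, hS σ hσ.1 ⟨x, hxσ, hx⟩⟩, hxσ⟩

theorem restrict_isSubcomplex :
    (X.restrict S hS).IsSubcomplex X.toPolyhedralComplex := by
  refine ⟨sUnion_subset_sUnion (sep_subset _ _), fun σ hσ => ⟨σ, hσ.1, subset_rfl⟩,
    fun σ hσ τ hτ hστ => ⟨?_, ?_⟩⟩
  · exact (X.intAffine σ hσ.1 τ hτ).mono (subset_inter subset_rfl hστ)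
  · exact (X.intAffine τ hτ σ hσ.1).mono (subset_inter hστ subset_rfl)

theorem restrict_agreeOn : (X.restrict S hS).AgreeOn X X.cells := by
  intro τ hτ
  rw [minCell_of_mem hτ.1.1]
  exact ⟨IntAffineOn.refl _ _, IntAffineOn.refl _ _⟩

end TropicalComplex

theorem mainTheorem9 {T E F : Type*} [TopologicalSpace T] [TopologicalSpace E]
    [TopologicalSpace F] {n e f : ℕ} {X : TropicalCycle T n}
    (𝓔 : TropicalVectorBundle X e E) (𝓕 : TropicalVectorBundle X f F)
    (φ : TropicalBundleHom 𝓔 𝓕) (k : ℕ) :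
    (∀ p M, φ.IsStalkMatrix p M → (p ∈ φ.degeneracyLocus k ↔ M.rank ≤ k)) ∧
    (∀ p ∈ φ.degeneracyLocus k,
      connectedComponentIn X.support p ⊆ φ.degeneracyLocus k) ∧
    ∃ D : TropicalCycle T n, D.IsSubcycle X ∧ D.IsWeightedSubcycle X ∧
      D.support = φ.degeneracyLocus k := by
  have hclopen := φ.isClopen_degeneracyLocus k
  refine ⟨fun p M h => h.mem_degeneracyLocus_iff k, fun p hp => ?_, ?_⟩
  · exact isPreconnected_connectedComponentIn.subset_of_isClopen_preimage hclopen
      (connectedComponentIn_subset _ _) ⟨p, mem_connectedComponentIn hp.1, hp⟩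
  · -- The bundle projection is a morphism, which provides a reduced representative of `X`.
    obtain ⟨-, -, -, Y, -, hY, -, hred, -⟩ := 𝓔.isMorphism
    have hsupp : ⋃₀ Y.star = X.support := by rw [← hY]; rfl
    have hsat : PolyhedralComplex.Saturates (φ.degeneracyLocus k) Y.toPolyhedralComplex := by
      intro σ hσ hne
      refine (Y.isPreconnected hσ).subset_of_isClopen_preimage hclopen ?_ hne
      rw [← hsupp, hred]
      exact subset_sUnion_of_mem hσ
    refine ⟨TropicalCycle.mk (Y.restrict _ hsat), ?_, ?_, ?_⟩
    · exact ⟨_, Y, rfl, hY, hred, TropicalComplex.restrict_isSubcomplex,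
        TropicalComplex.restrict_agreeOn⟩
    · refine ⟨_, Y, rfl, hY, hred, TropicalComplex.restrict_isSubcomplex,
        TropicalComplex.restrict_agreeOn, fun τ hτ _ => ?_⟩
      rw [minCell_of_mem hτ.1]
      rfl
    · exact TropicalComplex.support_restrict (hsupp ▸ fun p hp => hp.1)
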